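/- Let $J\ge 2$ and $0\le J_0\le J-1$ be integers. Let $\mathcal Z=\{0,\dots,J-1\}$ if $J_0=0$ and $\mathcal Z=\{0,J_0,\dots,J-1\}$ if $J_0\ge 1$. For $0\le j\le J-1$ put $\mathcal Z(j)=\mathcal Z$ if $j<J_0$ and $\mathcal Z(j)=\mathcal Z\setminus\{j\}$ if $j\ge J_0$. Let $\mathbf Q_1^Y$ be the set of all probability distributions $Q$ of random vectors $(Y_0,\dots,Y_{J-1},(D_z:z\in\mathcal Z),Z)$, with real potential outcomes $Y_d$, potential treatments $D_z\in\{0,\dots,J-1\}$ and an instrument $Z\in\mathcal Z$, such that - $(Y_0,\dots,Y_{J-1},(D_z:z\in\mathcal Z))$ is independent of $Z$ under $Q$; - $Q\{Z=z\}>0$ for every $z\in\mathcal Z$; - there is a random variable $j^*$ with values in $\{0,\dots,J-1\}$ such that $Q\{D_z\in\{z,j^*\}\}=1$ for every $z\in\mathcal Z$, where moreover $Q\{j^*=D_0\}=1$ if $J_0>0$. Let $T$ be the map that sends $(Y_0,\dots,Y_{J-1},(D_z:z\in\mathcal Z),Z)$ to the observed vector $(Y,D,Z)$, where $D=\sum_{z\in\mathcal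 Z}D_z I\{Z=z\}$ and $Y=\sum_{0\le d\le J-1}Y_d I\{D=d\}$. **Theorem.** Let $P$ be a probability distribution of $(Y,D,Z)$ on $\mathbf R\times\{0,\dots,J-1\}\times\mathcal Z$ such that $P\{Z=z\}>0$ for every $z\in\mathcal Z$, and let $\mathcal Y\subseteq\mathbf R$ be the support of $Y$ under $P$, that is, the smallest closed set with $P\{Y\in\mathcal Y\}=1$. Then $P=QT^{-1}$ for some $Q\in\mathbf Q_1^Y$ if and only if both of the following conditions hold: (a) whenever, for each $0\le j\le J-1$, the Borel sets $\{B_z(j):z\in\mathcal Z(j)\}$ form a partition of $\mathcal Y$ (empty parts being allowed), $$\sum_{0\le j\le J-1}\ \sum_{z\in\mathcal Z(j)}P\{Y\in B_z(j),\,D=j\mid Z=z\}\le 1;$$ (b) for each Borel set $B\subseteq\mathcal Y$, each $J_0\le j\le J-1$ and each $k\in\mathcal Z$ with $k\ne j$, $$P\{Y\in B,\,D=j\mid Z=k\}\le P\{Y\in B,\,D=j\mid Z=j\}.$$ -/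

import Mathlib

open MeasureTheory ProbabilityTheory

noncomputable section

namespace EncouragementDesign

/-- The set of instrument values `{0, J₀, …, J - 1}`, as a subtype of `{0, …, J - 1}`.
For `J₀ = 0` it consists of all of `{0, …, J - 1}`. -/
abbrev Instr (J J₀ : ℕ) : Type := {z : Fin J // (z : ℕ) = 0 ∨ J₀ ≤ (z : ℕ)}

/-- The set `𝒵(j)`: all instrument values if `j < J₀`, and all those different from `j`
if `J₀ ≤ j`. -/
def instrFor (J J₀ : ℕ) (j : Fin J) : Finset (Instr J J₀) :=
  Finset.univ.filter fun z => (j : ℕ) < J₀ ∨ (z : Fin J) ≠ j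

/-- Values of the observed vector `(Y, D, Z)`. -/
abbrev Observed (J J₀ : ℕ) : Type := ℝ × Fin J × Instr J J₀

/-- Values of the latent vector `(((Y₀, …, Y_{J-1}), (D_z : z ∈ 𝒵)), Z)`. -/
abbrev Latent (J J₀ : ℕ) : Type := ((Fin J → ℝ) × (Instr J J₀ → Fin J)) × Instr J J₀

namespace Latent

variable {J J₀ : ℕ}

/-- The potential outcome `Y_d`. -/
def potY (d : Fin J) (ω : Latent J J₀) : ℝ := ω.1.1 d

/-- The potential treatment `D_z`. -/
def potD (z : Instr J J₀) (ω : Latent J J₀) : Fin J := ω.1.2 z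

/-- The instrument `Z`. -/
def inst (ω : Latent J J₀) : Instr J J₀ := ω.2

/-- The observed treatment: `D = D_z` on the event `Z = z`. -/
def obsD (ω : Latent J J₀) : Fin J := potD (inst ω) ω

/-- The observed outcome: `Y = Y_d` on the event `D = d`. -/
def obsY (ω : Latent J J₀) : ℝ := potY (obsD ω) ω

/-- The map `T` from the latent vector to the observed vector `(Y, D, Z)`. -/
def observe (ω : Latent J J₀) : Observed J J₀ := (obsY ω, obsD ω, inst ω)

end Latent

/-- `Q` is the distribution of a latent vector that belongs to the model. -/
structure IsModel (J J₀ : ℕ) (Q : Measure (Latent J J₀)) : Prop where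
  /-- `Q` is a probability distribution. -/
  isProb : IsProbabilityMeasure Q
  /-- Exogeneity: `((Y_d)_d, (D_z)_z)` is independent of `Z`. -/
  exog : IndepFun (fun ω : Latent J J₀ => ω.1) (fun ω => Latent.inst ω) Q
  /-- Overlap: every value of the instrument has positive probability. -/
  overlap : ∀ z : Instr J J₀, 0 < Q {ω | Latent.inst ω = z}
  /-- There is a random default choice `j*` with `D_z ∈ {z, j*}` almost surely for every
  instrument value `z`; when `J₀ > 0` the default choice is `D₀`. -/
  default : ∃ jstar : Latent J J₀ → Fin J, Measurable jstar ∧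
    (∀ z : Instr J J₀, ∀ᵐ ω ∂Q, Latent.potD z ω = (z : Fin J) ∨ Latent.potD z ω = jstar ω) ∧
    (0 < J₀ → ∀ z : Instr J J₀, ((z : Fin J) : ℕ) = 0 → ∀ᵐ ω ∂Q, jstar ω = Latent.potD z ω)

/-- The support of the observed outcome `Y` under `P`. -/
def outcomeSupport {J J₀ : ℕ} (P : Measure (Observed J J₀)) : Set ℝ :=
  (P.map Prod.fst).support

/-- The conditional probability `P{Y ∈ B, D = j | Z = z}`. -/
def condProb {J J₀ : ℕ} (P : Measure (Observed J J₀)) (B : Set ℝ) (j : Fin J)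
    (z : Instr J J₀) : ENNReal :=
  ProbabilityTheory.cond P {ω | ω.2.2 = z} {ω | ω.1 ∈ B ∧ ω.2.1 = j}

/-- For all families of Borel partitions `{B_z(j) : z ∈ 𝒵(j)}` of the support of `Y`
(parts may be empty), `∑_j ∑_{z ∈ 𝒵(j)} P{Y ∈ B_z(j), D = j | Z = z} ≤ 1`. -/
def PartitionIneq {J J₀ : ℕ} (P : Measure (Observed J J₀)) : Prop :=
  ∀ B : Fin J → Instr J J₀ → Set ℝ,
    (∀ j, ∀ z ∈ instrFor J J₀ j, MeasurableSet (B j z)) →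
    (∀ j, (instrFor J J₀ j : Set (Instr J J₀)).PairwiseDisjoint (B j)) →
    (∀ j, (⋃ z ∈ instrFor J J₀ j, B j z) = outcomeSupport P) →
    ∑ j : Fin J, ∑ z ∈ instrFor J J₀ j, condProb P (B j z) j z ≤ 1

/-- For Borel `B` in the support of `Y`, `J₀ ≤ j ≤ J - 1` and `k ≠ j` in `𝒵`,
`P{Y ∈ B, D = j | Z = k} ≤ P{Y ∈ B, D = j | Z = j}`. -/
def TargetingIneq {J J₀ : ℕ} (P : Measure (Observed J J₀)) : Prop :=
  ∀ B : Set ℝ, MeasurableSet B → B ⊆ outcomeSupport P →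
    ∀ (j : Fin J) (hj : J₀ ≤ (j : ℕ)) (k : Instr J J₀), (k : Fin J) ≠ j →
      condProb P B j k ≤ condProb P B j ⟨j, Or.inr hj⟩

end EncouragementDesign

end

namespace EncouragementDesign

variable {J J₀ : ℕ}

namespace Latent

/-! Write μ_{z,j} for the law of Y on {D = j} given Z = z; exogeneity makes it the law of Y_j on
{D_z = j}. Necessity: if z ∈ 𝒵(j), the event D_z = j forces j* = j (`default_eq_of_mem_instrFor`),
so the events summed in (a) are almost surely disjoint. If D_k = j with k ≠ j, then j* = j, hence
D_j = j; this is (b).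

Sufficiency: look for ν_j, the law of Y_j on {j* = j}. It must dominate every μ_{z,j} with z ∈ 𝒵(j),
hence their lattice supremum M_j; it must lie below μ_{j,j} if J₀ ≤ j; and the total masses must add
up to 1. The supremum is attained on a Borel partition, so (a) says that the M_j have total mass at
most 1. By (b) the upper bounds dominate the M_j and have total mass at least 1. A convex
combination of the bounds therefore has mass exactly 1 (`exists_default_laws`). Given the ν_j, draw
j* and Y_{j*}, and let one uniform variable decide whether D_z is j* or z, with conditional
probability dμ_{z,j}/dν_j of the former on {j* = j}. The missing part μ_{z,z} - ν_z has exactly the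
mass of {j* ≠ z, D_z = z}, so it is supplied by drawing Y_z there from the normalized residual
(`exists_potential_law`). -/

theorem measurable_inst : Measurable (inst : Latent J J₀ → Instr J J₀) := measurable_snd

theorem measurable_potD (z : Instr J J₀) : Measurable (potD z) := by
  unfold potD; fun_prop

theorem measurable_potY (d : Fin J) : Measurable (potY d : Latent J J₀ → ℝ) := by
  unfold potY; fun_prop

theorem measurable_obsD : Measurable (obsD : Latent J J₀ → Fin J) :=
  measurable_from_prod_countable_left fun z => measurable_potD z |>.comp measurable_prodMk_right

theorem measurable_obsY : Measurable (obsY : Latent J J₀ → ℝ) := by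
  have h : Measurable fun p : (Latent J J₀) × Fin J => potY p.2 p.1 :=
    measurable_from_prod_countable_left fun d => measurable_potY d
  exact h.comp (measurable_id.prodMk measurable_obsD)

theorem measurable_observe : Measurable (observe : Latent J J₀ → Observed J J₀) :=
  measurable_obsY.prodMk (measurable_obsD.prodMk measurable_inst)

end Latent

theorem measurableSet_outcomeSupport (P : Measure (Observed J J₀)) :
    MeasurableSet (outcomeSupport P) :=
  Measure.isClosed_support.measurableSet

theorem measurableSet_instrument_eq (z : Instr J J₀) :
    MeasurableSet {ω : Observed J J₀ | ω.2.2 = z} :=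
  measurable_snd.snd (measurableSet_singleton z)

theorem measurableSet_outcome_treatment {B : Set ℝ} (hB : MeasurableSet B) (j : Fin J) :
    MeasurableSet {ω : Observed J J₀ | ω.1 ∈ B ∧ ω.2.1 = j} :=
  (measurable_fst hB).inter (measurable_snd.fst (measurableSet_singleton j))

theorem measurableSet_potential {B : Set ℝ} (hB : MeasurableSet B) (j : Fin J) (z : Instr J J₀) :
    MeasurableSet {x : (Fin J → ℝ) × (Instr J J₀ → Fin J) | x.1 j ∈ B ∧ x.2 z = j} := by
  have h₁ : Measurable fun x : (Fin J → ℝ) × (Instr J J₀ → Fin J) => x.1 j := by fun_prop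
  have h₂ : Measurable fun x : (Fin J → ℝ) × (Instr J J₀ → Fin J) => x.2 z := by fun_prop
  exact (h₁ hB).inter (h₂ (measurableSet_singleton j))

theorem not_mem_instrFor_iff {j : Fin J} {z : Instr J J₀} :
    z ∉ instrFor J J₀ j ↔ J₀ ≤ (j : ℕ) ∧ (z : Fin J) = j := by
  simp [instrFor]

/-- If z ≠ j, a choice of j can only come from the default. If z = j, membership in 𝒵(j) gives j <
J₀, so z = 0 and the default is D₀ itself. -/
theorem default_eq_of_mem_instrFor {j i d : Fin J} {z : Instr J J₀} (hz : z ∈ instrFor J J₀ j)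
    (hd : d = z ∨ d = i) (h0 : 0 < J₀ → ((z : Fin J) : ℕ) = 0 → i = d) (hj : d = j) : i = j := by
  subst hj
  rcases hd with hd | hd
  · simp only [instrFor, Finset.mem_filter, Finset.mem_univ, true_and] at hz
    rcases hz with hz | hz
    · refine h0 (by omega) ?_
      rcases z.2 with h | h
      · exact h
      · rw [← hd] at h; omega
    · exact absurd hd.symm hz
  · exact hd.symm

/-! ### Necessity of the two conditions -/

/-- Under exogeneity, conditioning on the instrument identifies the law of potential variables. -/
theorem IsModel.condProb_map {Q : Measure (Latent J J₀)} (hQ : IsModel J J₀ Q) {B : Set ℝ}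
    (hB : MeasurableSet B) (j : Fin J) (z : Instr J J₀) :
    condProb (Q.map Latent.observe) B j z =
      Q {ω | Latent.potY j ω ∈ B ∧ Latent.potD z ω = j} := by
  have := hQ.isProb
  rw [condProb, cond_apply (measurableSet_instrument_eq z),
    Measure.map_apply Latent.measurable_observe (measurableSet_instrument_eq z),
    Measure.map_apply Latent.measurable_observe
      ((measurableSet_instrument_eq z).inter (measurableSet_outcome_treatment hB j))]
  have h₁ : Latent.observe ⁻¹' {ω : Observed J J₀ | ω.2.2 = z} =
      {ω | Latent.inst ω = z} := rfl
  have h₂ : Latent.observe ⁻¹' ({ω : Observed J J₀ | ω.2.2 = z} ∩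
      {ω | ω.1 ∈ B ∧ ω.2.1 = j}) =
      (fun ω : Latent J J₀ => ω.1) ⁻¹' {x | x.1 j ∈ B ∧ x.2 z = j} ∩ Latent.inst ⁻¹' {z} := by
    ext ω
    simp only [Latent.observe, Latent.obsY, Latent.obsD, Latent.potY, Latent.potD, Latent.inst,
      Set.mem_preimage, Set.mem_inter_iff, Set.mem_ofPred_eq, Set.mem_singleton_iff]
    constructor
    · rintro ⟨rfl, h, rfl⟩; exact ⟨⟨h, rfl⟩, rfl⟩
    · rintro ⟨⟨h, rfl⟩, rfl⟩; exact ⟨rfl, h, rfl⟩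
  rw [h₁, h₂, hQ.exog.measure_inter_preimage_eq_mul _ _ (measurableSet_potential hB j z)
    (measurableSet_singleton z), mul_comm (Q _) (Q (Latent.inst ⁻¹' {z})), ← mul_assoc]
  have h₃ : (Q {ω | Latent.inst ω = z})⁻¹ * Q (Latent.inst ⁻¹' {z}) = 1 :=
    ENNReal.inv_mul_cancel (hQ.overlap z).ne' (measure_ne_top _ _)
  rw [h₃, one_mul]
  rfl

theorem IsModel.partitionIneq {Q : Measure (Latent J J₀)} (hQ : IsModel J J₀ Q) :
    PartitionIneq (Q.map Latent.observe) := by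
  intro B hB hd _
  have := hQ.isProb
  obtain ⟨i, -, hi, hi0⟩ := hQ.default
  let E : (Σ _ : Fin J, Instr J J₀) → Set (Latent J J₀) := fun p =>
    {ω | Latent.potY p.1 ω ∈ B p.1 p.2 ∧ Latent.potD p.2 ω = p.1}
  have hE : ∀ p ∈ Finset.univ.sigma (instrFor J J₀), MeasurableSet (E p) := by
    intro p hp
    exact measurable_fst (measurableSet_potential (hB p.1 p.2 (Finset.mem_sigma.1 hp).2) p.1 p.2)
  have hdef : ∀ p ∈ Finset.univ.sigma (instrFor J J₀), ∀ᵐ ω ∂Q, ω ∈ E p → i ω = p.1 := by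
    rintro ⟨j, z⟩ hp
    have h0 : 0 < J₀ → ((z : Fin J) : ℕ) = 0 → ∀ᵐ ω ∂Q, i ω = Latent.potD z ω :=
      fun h h' => hi0 h z h'
    have h0' : ∀ᵐ ω ∂Q, 0 < J₀ → ((z : Fin J) : ℕ) = 0 → i ω = Latent.potD z ω := by
      simpa only [Filter.eventually_imp_distrib_left] using h0
    filter_upwards [hi z, h0'] with ω h₁ h₂ h₃
    exact default_eq_of_mem_instrFor (Finset.mem_sigma.1 hp).2 h₁ h₂ h₃.2
  calc ∑ j, ∑ z ∈ instrFor J J₀ j, condProb (Q.map Latent.observe) (B j z) j z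
      = ∑ p ∈ Finset.univ.sigma (instrFor J J₀), Q (E p) := by
        rw [Finset.sum_sigma]
        exact Finset.sum_congr rfl fun j _ => Finset.sum_congr rfl fun z hz =>
          hQ.condProb_map (hB j z hz) j z
    _ = Q (⋃ p ∈ Finset.univ.sigma (instrFor J J₀), E p) := by
        -- For different j the events force different values of j*; for the same j they are disjoint
        -- because the parts of the partition are.
        refine (measure_biUnion_finset₀ ?_ fun p hp => (hE p hp).nullMeasurableSet).symm
        rintro ⟨j, z⟩ hp ⟨j', z'⟩ hp' hne
        rw [Function.onFun, AEDisjoint, measure_eq_zero_iff_ae_notMem]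
        filter_upwards [hdef _ hp, hdef _ hp'] with ω h₁ h₂ h
        obtain rfl : j = j' := (h₁ h.1).symm.trans (h₂ h.2)
        have hz : z ≠ z' := fun e => hne (by rw [e])
        exact Set.disjoint_left.1 (hd j (Finset.mem_sigma.1 hp).2 (Finset.mem_sigma.1 hp').2 hz)
          h.1.1 h.2.1
    _ ≤ 1 := prob_le_one

theorem IsModel.targetingIneq {Q : Measure (Latent J J₀)} (hQ : IsModel J J₀ Q) :
    TargetingIneq (Q.map Latent.observe) := by
  intro B hB _ j hj k hk
  obtain ⟨i, -, hi, -⟩ := hQ.default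
  rw [hQ.condProb_map hB, hQ.condProb_map hB]
  refine measure_mono_ae ?_
  filter_upwards [hi k, hi ⟨j, Or.inr hj⟩] with ω h₁ h₂ h
  have hij : i ω = j := by
    rcases h₁ with h₁ | h₁
    · exact absurd (h₁.symm.trans h.2) hk
    · exact h₁.symm.trans h.2
  refine ⟨h.1, ?_⟩
  rcases h₂ with h₂ | h₂
  · exact h₂
  · exact h₂.trans hij

/-! ### From a law of the potential variables to a model -/

/-- A finite measure on observed vectors is determined by its values on rectangles. -/
theorem measure_observed_ext {P R : Measure (Observed J J₀)}
    (h : ∀ (B : Set ℝ) (j : Fin J) (z : Instr J J₀), MeasurableSet B →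
      P ({ω | ω.2.2 = z} ∩ {ω | ω.1 ∈ B ∧ ω.2.1 = j}) =
        R ({ω | ω.2.2 = z} ∩ {ω | ω.1 ∈ B ∧ ω.2.1 = j})) : P = R := by
  have key : ∀ (M : Measure (Observed J J₀)) (s : Set (Observed J J₀)), MeasurableSet s →
      M s = ∑ p : Fin J × Instr J J₀, M ({ω | ω.2.2 = p.2} ∩
        {ω | ω.1 ∈ (fun y => (y, p)) ⁻¹' s ∧ ω.2.1 = p.1}) := by
    intro M s hs
    have hu := sum_measure_preimage_singleton (μ := M.restrict s) Finset.univ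
      (f := fun ω : Observed J J₀ => ω.2)
      (fun p _ => measurable_snd (measurableSet_singleton p))
    rw [Finset.coe_univ, Set.preimage_univ, Measure.restrict_apply_univ] at hu
    rw [← hu]
    refine Finset.sum_congr rfl fun p _ => ?_
    rw [Measure.restrict_apply (measurable_snd (measurableSet_singleton p))]
    congr 1
    ext ⟨y, d, z⟩
    obtain ⟨d', z'⟩ := p
    simp only [Set.mem_inter_iff, Set.mem_preimage, Set.mem_singleton_iff, Set.mem_ofPred_eq,
      Prod.mk.injEq]
    constructor
    · rintro ⟨⟨rfl, rfl⟩, hy⟩; exact ⟨rfl, hy, rfl⟩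
    · rintro ⟨rfl, hy, rfl⟩; exact ⟨⟨rfl, rfl⟩, hy⟩
  ext s hs
  rw [key P s hs, key R s hs]
  exact Finset.sum_congr rfl fun p _ => h _ _ _ (measurable_prodMk_right hs)

/-- A law of the potential variables that has the observed conditional laws, combined with an
independent instrument, rationalizes the observed distribution. -/
theorem exists_isModel_of_potential_law {P : Measure (Observed J J₀)} [IsProbabilityMeasure P]
    (hZ : ∀ z : Instr J J₀, 0 < P {ω | ω.2.2 = z})
    (L : Measure ((Fin J → ℝ) × (Instr J J₀ → Fin J))) [IsProbabilityMeasure L]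
    (hL : ∀ᵐ x ∂L, ∃ i, ∀ z : Instr J J₀, (x.2 z = (z : Fin J) ∨ x.2 z = i) ∧
      (0 < J₀ → ((z : Fin J) : ℕ) = 0 → i = x.2 z))
    (hLP : ∀ j z (B : Set ℝ), MeasurableSet B →
      L {x | x.1 j ∈ B ∧ x.2 z = j} = condProb P B j z) :
    ∃ Q : Measure (Latent J J₀), IsModel J J₀ Q ∧ P = Q.map Latent.observe := by
  classical
  have hmZ : Measurable fun ω : Observed J J₀ => ω.2.2 := measurable_snd.snd
  have hZp : IsProbabilityMeasure (P.map fun ω => ω.2.2) :=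
    Measure.isProbabilityMeasure_map hmZ.aemeasurable
  have hPz : ∀ z, (P.map fun ω => ω.2.2) {z} = P {ω | ω.2.2 = z} := fun z =>
    Measure.map_apply hmZ (measurableSet_singleton z)
  have hJ : Nonempty (Fin J) := by
    obtain ⟨ω⟩ := nonempty_of_isProbabilityMeasure P
    exact ⟨ω.2.1⟩
  let R : (Instr J J₀ → Fin J) → Fin J → Prop := fun D i => ∀ z, (D z = (z : Fin J) ∨ D z = i) ∧
      (0 < J₀ → ((z : Fin J) : ℕ) = 0 → i = D z)
  -- The default is chosen as a function of (D_z) alone, which ranges over a finite set, so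
  -- measurability is free.
  let g : (Instr J J₀ → Fin J) → Fin J := fun D => Classical.epsilon (R D)
  have hg : ∀ᵐ ω ∂(L.prod (P.map fun ω => ω.2.2)), R ω.1.2 (g ω.1.2) := by
    have h : ∀ᵐ x ∂L, R x.2 (g x.2) := by
      filter_upwards [hL] with x hx using Classical.epsilon_spec hx
    exact Measure.quasiMeasurePreserving_fst.ae h
  refine ⟨L.prod (P.map fun ω => ω.2.2), ⟨inferInstance, ?_, ?_, ?_⟩, ?_⟩
  · exact indepFun_prod measurable_id measurable_id
  · intro z
    have : {ω : Latent J J₀ | Latent.inst ω = z} = Set.univ ×ˢ {z} := by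
      ext; simp [Latent.inst]
    rw [this, Measure.prod_prod, measure_univ, one_mul, hPz]
    exact hZ z
  · refine ⟨fun ω => g ω.1.2, (measurable_of_finite g).comp measurable_fst.snd, ?_, ?_⟩
    · intro z
      filter_upwards [hg] with ω h using (h z).1
    · intro h0 z hz
      filter_upwards [hg] with ω h using (h z).2 h0 hz
  · refine measure_observed_ext fun B j z hB => ?_
    rw [Measure.map_apply Latent.measurable_observe
      ((measurableSet_instrument_eq z).inter (measurableSet_outcome_treatment hB j))]
    have : Latent.observe ⁻¹' ({ω : Observed J J₀ | ω.2.2 = z} ∩ {ω | ω.1 ∈ B ∧ ω.2.1 = j}) =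
        {x | x.1 j ∈ B ∧ x.2 z = j} ×ˢ {z} := by
      ext ω
      simp only [Latent.observe, Latent.obsY, Latent.obsD, Latent.potY, Latent.potD, Latent.inst,
        Set.mem_preimage, Set.mem_inter_iff, Set.mem_ofPred_eq, Set.mem_prod,
        Set.mem_singleton_iff]
      constructor
      · rintro ⟨rfl, h, rfl⟩; exact ⟨⟨h, rfl⟩, rfl⟩
      · rintro ⟨⟨h, rfl⟩, rfl⟩; exact ⟨rfl, h, rfl⟩
    rw [this, Measure.prod_prod, hPz, hLP j z B hB, condProb,
      cond_mul_eq_inter (measurableSet_instrument_eq z)]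

/-! ### Potential variables built from the default laws -/

/-- A finite measure that dominates `ν` is `ν` plus a multiple of a probability measure. -/
theorem exists_residual_law {ν μ : Measure ℝ} [IsFiniteMeasure ν] [IsFiniteMeasure μ]
    (h : ν ≤ μ) {c : ENNReal} (hc : ν Set.univ + c = μ Set.univ) :
    ∃ ρ : Measure ℝ, IsProbabilityMeasure ρ ∧
      ∀ B, MeasurableSet B → ν B + c * ρ B = μ B := by
  have hsum : μ - ν + ν = μ := Measure.sub_add_cancel_of_le h
  have hcu : (μ - ν) Set.univ = c := by
    have h₁ : (μ - ν) Set.univ + ν Set.univ = c + ν Set.univ := by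
      rw [add_comm c, hc]
      conv_rhs => rw [← hsum]
      rfl
    exact (ENNReal.add_left_inj (measure_ne_top ν _)).1 h₁
  rcases eq_or_ne c 0 with rfl | hc0
  -- With no residual mass any probability measure serves.
  · refine ⟨Measure.dirac 0, inferInstance, fun B _ => ?_⟩
    rw [Measure.measure_univ_eq_zero.1 hcu, zero_add] at hsum
    rw [hsum, zero_mul, add_zero]
  · have hct : c ≠ ⊤ := hcu ▸ measure_ne_top _ _
    refine ⟨c⁻¹ • (μ - ν), ⟨?_⟩, fun B _ => ?_⟩
    · rw [Measure.smul_apply, hcu, smul_eq_mul, ENNReal.inv_mul_cancel hc0 hct]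
    · rw [Measure.smul_apply, smul_eq_mul, ← mul_assoc, ENNReal.mul_inv_cancel hc0 hct, one_mul,
        add_comm]
      conv_rhs => rw [← hsum]
      rfl

theorem measurableSet_snd_le {f : ℝ → unitInterval} (hf : Measurable f) :
    MeasurableSet {p : ℝ × unitInterval | p.2 ≤ f p.1} :=
  measurableSet_le measurable_snd (hf.comp measurable_fst)

/-- Fubini: the slice over y ∈ B is an initial interval of length f y. -/
theorem prod_volume_snd_le {ν : Measure ℝ} [IsFiniteMeasure ν] {f : ℝ → unitInterval}
    (hf : Measurable f) {B : Set ℝ} (hB : MeasurableSet B) :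
    (ν.prod volume) {p : ℝ × unitInterval | p.1 ∈ B ∧ p.2 ≤ f p.1} =
      ∫⁻ y in B, ENNReal.ofReal (f y) ∂ν := by
  have hm : MeasurableSet {p : ℝ × unitInterval | p.1 ∈ B ∧ p.2 ≤ f p.1} :=
    (measurable_fst hB).inter (measurableSet_snd_le hf)
  rw [Measure.prod_apply hm, ← lintegral_indicator hB]
  refine lintegral_congr fun y => ?_
  by_cases hy : y ∈ B
  · rw [Set.indicator_of_mem hy, ← unitInterval.volume_Iic]
    congr 1
    ext u
    simp [hy]
  · simp [hy]

/-- Potential variables for default choice `i`: the outcome `Y_i` is `x.1.1`, the other outcomes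
are read off `x.2`, and `D_z = i` if the randomization device `x.1.2` is at most `f z Y_i`. -/
noncomputable def response (i : Fin J) (f : Instr J J₀ → ℝ → unitInterval)
    (x : (ℝ × unitInterval) × (Fin J → ℝ)) : (Fin J → ℝ) × (Instr J J₀ → Fin J) :=
  (fun d => if d = i then x.1.1 else x.2 d, fun z => if x.1.2 ≤ f z x.1.1 then i else z)

theorem measurable_response (i : Fin J) {f : Instr J J₀ → ℝ → unitInterval}
    (hf : ∀ z, Measurable (f z)) : Measurable (response i f) := by
  refine Measurable.prodMk (measurable_pi_lambda _ fun d => ?_)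
    (measurable_pi_lambda _ fun z => ?_)
  · by_cases h : d = i
    · simp only [h, if_true]; fun_prop
    · simp only [h, if_false]; fun_prop
  · exact Measurable.ite (measurable_fst (measurableSet_snd_le (hf z))) measurable_const
      measurable_const

/-- Existence of a joint law of the potential variables, given the law `ν j` of `Y_j` on
`{j* = j}` and the conditional probabilities `f j z` of `D_z = j` given `j* = j` and `Y_j`. -/
theorem exists_potential_law (μ : Instr J J₀ → Fin J → Measure ℝ) (ν : Fin J → Measure ℝ)
    [∀ z j, IsFiniteMeasure (μ z j)] [∀ j, IsFiniteMeasure (ν j)]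
    (f : Fin J → Instr J J₀ → ℝ → unitInterval) (hf : ∀ j z, Measurable (f j z))
    (hμ : ∀ z, ∑ j, μ z j Set.univ = 1) (hν : ∑ j, ν j Set.univ = 1)
    (hdens : ∀ j, ∀ z ∈ instrFor J J₀ j, ∀ B, MeasurableSet B →
      ∫⁻ y in B, ENNReal.ofReal (f j z y) ∂ν j = μ z j B)
    (hle : ∀ z : Instr J J₀, J₀ ≤ ((z : Fin J) : ℕ) → ν z ≤ μ z z)
    (h0 : 0 < J₀ → ∀ z : Instr J J₀, ((z : Fin J) : ℕ) = 0 → ∀ j y, f j z y = 1) :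
    ∃ L : Measure ((Fin J → ℝ) × (Instr J J₀ → Fin J)), IsProbabilityMeasure L ∧
      (∀ᵐ x ∂L, ∃ i, ∀ z : Instr J J₀, (x.2 z = (z : Fin J) ∨ x.2 z = i) ∧
        (0 < J₀ → ((z : Fin J) : ℕ) = 0 → i = x.2 z)) ∧
      ∀ j z (B : Set ℝ), MeasurableSet B → L {x | x.1 j ∈ B ∧ x.2 z = j} = μ z j B := by
  classical
  -- `c i z` is the mass of {j* = i} on which the device rejects the default, so that D_z = z.
  let c : Fin J → Instr J J₀ → ENNReal := fun i z =>
    ((ν i).prod volume) {p : ℝ × unitInterval | p.2 ≤ f i z p.1}ᶜ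
  have hc : ∀ i, ∀ z ∈ instrFor J J₀ i, μ z i Set.univ + c i z = ν i Set.univ := by
    intro i z hz
    rw [← hdens i z hz _ MeasurableSet.univ, ← prod_volume_snd_le (hf i z) MeasurableSet.univ]
    simp only [Set.mem_univ, true_and]
    rw [measure_add_measure_compl (measurableSet_snd_le (hf i z)), ← Set.univ_prod_univ,
      Measure.prod_prod, measure_univ (μ := volume), mul_one]
  -- Both ν and arm z have total mass 1; cancelling the masses μ_{z,i}, i ≠ z, leaves the mass that
  -- the residual law must carry.
  have hcsum : ∀ z : Instr J J₀, J₀ ≤ ((z : Fin J) : ℕ) →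
      ν z Set.univ + ∑ i ∈ Finset.univ.erase (z : Fin J), c i z = μ z z Set.univ := by
    intro z hz
    have h₁ : ∑ i ∈ Finset.univ.erase (z : Fin J), (μ z i Set.univ + c i z) =
        ∑ i ∈ Finset.univ.erase (z : Fin J), ν i Set.univ := by
      refine Finset.sum_congr rfl fun i hi => hc i z ?_
      by_contra h
      exact (Finset.mem_erase.1 hi).1 (not_mem_instrFor_iff.1 h).2.symm
    have h₂ := Finset.add_sum_erase Finset.univ (fun i => μ z i Set.univ)
      (Finset.mem_univ (z : Fin J))
    have h₃ := Finset.add_sum_erase Finset.univ (fun i => ν i Set.univ)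
      (Finset.mem_univ (z : Fin J))
    rw [hμ z] at h₂
    rw [hν, ← h₁, Finset.sum_add_distrib, ← h₂] at h₃
    have hfin : ∑ i ∈ Finset.univ.erase (z : Fin J), μ z i Set.univ ≠ ⊤ :=
      ENNReal.sum_ne_top.2 fun i _ => measure_ne_top _ _
    refine (ENNReal.add_left_inj hfin).1 (Eq.trans ?_ h₃)
    rw [add_assoc, add_comm (∑ i ∈ _, c i z)]
  have hρ : ∀ j : Fin J, ∃ ρ : Measure ℝ, IsProbabilityMeasure ρ ∧
      ∀ (hj : J₀ ≤ (j : ℕ)) (B : Set ℝ), MeasurableSet B →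
        ν j B + (∑ i ∈ Finset.univ.erase j, c i ⟨j, Or.inr hj⟩) * ρ B =
          μ ⟨j, Or.inr hj⟩ j B := by
    intro j
    by_cases hj : J₀ ≤ (j : ℕ)
    · obtain ⟨ρ, h₁, h₂⟩ := exists_residual_law (hle ⟨j, Or.inr hj⟩ hj)
        (hcsum ⟨j, Or.inr hj⟩ hj)
      exact ⟨ρ, h₁, fun _ => h₂⟩
    · exact ⟨Measure.dirac 0, inferInstance, fun h => absurd h hj⟩
  choose ρ hρp hρ using hρ
  have hm : ∀ i, Measurable (response i (f i)) := fun i => measurable_response i (hf i)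
  -- Non-default outcomes are drawn from the residual laws, independently of Y_i and of the device.
  let K : Fin J → Measure ((ℝ × unitInterval) × (Fin J → ℝ)) := fun i =>
    ((ν i).prod volume).prod (Measure.pi ρ)
  have hKu : ∀ i, K i Set.univ = ν i Set.univ := by
    intro i
    rw [← Set.univ_prod_univ, Measure.prod_prod, ← Set.univ_prod_univ, Measure.prod_prod]
    simp
  have happ : ∀ S, MeasurableSet S →
      (∑ i, (K i).map (response i (f i))) S = ∑ i, K i (response i (f i) ⁻¹' S) := by
    intro S hS
    rw [Measure.finsetSum_apply]
    exact Finset.sum_congr rfl fun i _ => Measure.map_apply (hm i) hS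
  refine ⟨∑ i, (K i).map (response i (f i)), ⟨?_⟩, ?_, ?_⟩
  · rw [happ _ MeasurableSet.univ, ← hν]
    exact Finset.sum_congr rfl fun i _ => hKu i
  · have hS : MeasurableSet {x : (Fin J → ℝ) × (Instr J J₀ → Fin J) |
        ∃ i, ∀ z : Instr J J₀, (x.2 z = (z : Fin J) ∨ x.2 z = i) ∧
          (0 < J₀ → ((z : Fin J) : ℕ) = 0 → i = x.2 z)} :=
      measurable_snd (Set.toFinite {D : Instr J J₀ → Fin J |
        ∃ i, ∀ z : Instr J J₀, (D z = (z : Fin J) ∨ D z = i) ∧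
          (0 < J₀ → ((z : Fin J) : ℕ) = 0 → i = D z)}).measurableSet
    rw [ae_iff]
    refine (happ _ hS.compl).trans (Finset.sum_eq_zero fun i _ => ?_)
    convert measure_empty (μ := K i)
    refine Set.eq_empty_of_forall_notMem fun x hx => hx ⟨i, fun z => ?_⟩
    simp only [response]
    refine ⟨?_, fun h h' => ?_⟩
    · split_ifs
      · exact Or.inr rfl
      · exact Or.inl rfl
    · rw [h0 h z h' i, if_pos (unitInterval.le_one')]
  · intro j z B hB
    rw [happ _ (measurableSet_potential hB j z)]
    by_cases hz : z ∈ instrFor J J₀ j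
    · rw [Finset.sum_eq_single_of_mem j (Finset.mem_univ j)]
      · have : response j (f j) ⁻¹' {x | x.1 j ∈ B ∧ x.2 z = j} =
            {p : ℝ × unitInterval | p.1 ∈ B ∧ p.2 ≤ f j z p.1} ×ˢ Set.univ := by
          ext x
          simp only [response, Set.mem_preimage, Set.mem_ofPred_eq, if_true, Set.mem_prod,
            Set.mem_univ, and_true]
          refine and_congr_right fun _ => ⟨fun h => ?_, fun h => if_pos h⟩
          by_contra hu
          rw [if_neg hu] at h
          -- Rejection could yield D_z = j only if z = j; then z = 0 < J₀, where `f` is 1 and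
          -- nothing is rejected.
          have hzj : (j : ℕ) < J₀ := by
            by_contra hlt
            exact not_mem_instrFor_iff.2 ⟨not_lt.1 hlt, h⟩ hz
          refine hu ?_
          rw [h0 (by omega) z ?_ j]
          · exact unitInterval.le_one'
          · rcases z.2 with h' | h'
            · exact h'
            · rw [h] at h'; omega
        rw [this, Measure.prod_prod, measure_univ, mul_one, prod_volume_snd_le (hf j z) hB,
          hdens j z hz B hB]
      · intro i _ hij
        convert measure_empty (μ := K i)
        refine Set.eq_empty_of_forall_notMem fun x hx => hij ?_
        refine default_eq_of_mem_instrFor (d := (response i (f i) x).2 z) hz ?_ ?_ hx.2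
        · simp only [response]
          split_ifs
          · exact Or.inr rfl
          · exact Or.inl rfl
        · intro h h'
          simp only [response]
          rw [h0 h z h' i, if_pos unitInterval.le_one']
    · obtain ⟨hj, rfl⟩ := not_mem_instrFor_iff.1 hz
      -- Targeted arm: default z always yields D_z = z and contributes ν_z, while each default i ≠ z
      -- contributes `c i z` times the residual law.
      rw [← Finset.add_sum_erase Finset.univ _ (Finset.mem_univ (z : Fin J)), ← hρ z hj B hB,
        Finset.sum_mul]
      congr 1
      · have : response (z : Fin J) (f z) ⁻¹' {x | x.1 z ∈ B ∧ x.2 z = (z : Fin J)} =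
            (B ×ˢ Set.univ) ×ˢ Set.univ := by
          ext x
          simp [response]
        rw [this, Measure.prod_prod, Measure.prod_prod]
        simp
      · refine Finset.sum_congr rfl fun i hi => ?_
        have hiz : i ≠ z := (Finset.mem_erase.1 hi).1
        have : response i (f i) ⁻¹' {x | x.1 z ∈ B ∧ x.2 z = (z : Fin J)} =
            {p : ℝ × unitInterval | p.2 ≤ f i z p.1}ᶜ ×ˢ (Function.eval (z : Fin J) ⁻¹' B) := by
          ext x
          simp [response, hiz, hiz.symm, and_comm]
        rw [this, Measure.prod_prod,
          (measurePreserving_eval ρ (z : Fin J)).measure_preimage hB.nullMeasurableSet]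

/-! ### Default laws between the lower and upper bounds -/

theorem measurable_finset_sup {ι : Type*} (s : Finset ι) {g : ι → ℝ → ENNReal}
    (hg : ∀ i, Measurable (g i)) : Measurable fun y => s.sup fun i => g i y := by
  simp only [Finset.sup_eq_iSup]
  exact Measurable.biSup _ s.countable_toSet fun i _ => hg i

/-- The integral of a finite pointwise supremum is attained on a Borel partition. -/
theorem exists_partition_sum_lintegral_eq {ι : Type*} [LinearOrder ι] (s : Finset ι)
    (hs : s.Nonempty) {g : ι → ℝ → ENNReal} (hg : ∀ i, Measurable (g i)) (κ : Measure ℝ) :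
    ∃ B : ι → Set ℝ, (∀ i, MeasurableSet (B i)) ∧ (s : Set ι).PairwiseDisjoint B ∧
      (⋃ i ∈ s, B i) = Set.univ ∧
      ∑ i ∈ s, ∫⁻ y in B i, g i y ∂κ = ∫⁻ y, s.sup (fun i => g i y) ∂κ := by
  have hM := measurable_finset_sup s hg
  have hA : ∀ i, MeasurableSet {y | g i y = s.sup fun i => g i y} := fun i =>
    measurableSet_eq_fun (hg i) hM
  -- Ties among maximizers go to the smallest index.
  let B : ι → Set ℝ := fun i => {y | g i y = s.sup fun i => g i y} \
    ⋃ k ∈ s.filter (· < i), {y | g k y = s.sup fun i => g i y}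
  have hB : ∀ i, MeasurableSet (B i) := fun i =>
    (hA i).diff (Finset.measurableSet_biUnion _ fun k _ => hA k)
  have hd : (s : Set ι).PairwiseDisjoint B := by
    have key : ∀ i ∈ s, ∀ k ∈ s, i < k → Disjoint (B i) (B k) := by
      intro i hi k _ hik
      refine Set.disjoint_left.2 fun y hyi hyk => hyk.2 ?_
      exact Set.mem_biUnion (Finset.mem_filter.2 ⟨hi, hik⟩) hyi.1
    intro i hi k hk hne
    rcases lt_or_gt_of_ne hne with h | h
    · exact key i hi k hk h
    · exact (key k hk i hi h).symm
  have hu : (⋃ i ∈ s, B i) = Set.univ := by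
    refine Set.eq_univ_of_forall fun y => ?_
    have hne : (s.filter fun i => g i y = s.sup fun i => g i y).Nonempty := by
      obtain ⟨i, hi, h⟩ := s.exists_mem_eq_sup hs fun i => g i y
      exact ⟨i, Finset.mem_filter.2 ⟨hi, h.symm⟩⟩
    have hmem := Finset.mem_filter.1 (Finset.min'_mem _ hne)
    refine Set.mem_biUnion hmem.1 ⟨hmem.2, fun h => ?_⟩
    obtain ⟨k, hk, hky⟩ := Set.mem_iUnion₂.1 h
    have hk' := Finset.mem_filter.1 hk
    exact absurd (Finset.min'_le _ k (Finset.mem_filter.2 ⟨hk'.1, hky⟩)) (not_le.2 hk'.2)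
  refine ⟨B, hB, hd, hu, ?_⟩
  rw [← setLIntegral_univ, ← hu, lintegral_biUnion_finset hd fun i _ => hB i]
  exact Finset.sum_congr rfl fun i _ => setLIntegral_congr_fun (hB i) fun y hy => hy.1

/-- The ratio g / h is the conditional probability; it is clamped to [0, 1] off the null set where g
≤ h fails. -/
theorem exists_unitInterval_density {κ : Measure ℝ} {g h : ℝ → ENNReal} (hg : Measurable g)
    (hh : Measurable h) (hgh : g ≤ᵐ[κ] h) (hint : ∫⁻ y, h y ∂κ ≠ ⊤) :
    ∃ f : ℝ → unitInterval, Measurable f ∧ ∀ B, MeasurableSet B →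
      ∫⁻ y in B, ENNReal.ofReal (f y) ∂(κ.withDensity h) = κ.withDensity g B := by
  have hf : Measurable fun y => Set.projIcc (0 : ℝ) 1 zero_le_one (g y / h y).toReal :=
    continuous_projIcc.measurable.comp (hg.div hh).ennreal_toReal
  refine ⟨_, hf, fun B hB => ?_⟩
  rw [setLIntegral_withDensity_eq_setLIntegral_mul κ hh
    hf.subtype_coe.ennreal_ofReal hB, withDensity_apply _ hB]
  refine setLIntegral_congr_fun_ae hB ?_
  filter_upwards [hgh, ae_lt_top hh hint] with y hy hlt _
  have h₁ : g y / h y ≤ 1 := ENNReal.div_le_of_le_mul (by rwa [one_mul])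
  have h₂ : (g y / h y).toReal ∈ Set.Icc (0 : ℝ) 1 :=
    ⟨ENNReal.toReal_nonneg, ENNReal.toReal_le_of_le_ofReal zero_le_one (by simpa using h₁)⟩
  rw [Pi.mul_apply, Set.projIcc_of_mem zero_le_one h₂,
    ENNReal.ofReal_toReal (ne_top_of_le_ne_top ENNReal.one_ne_top h₁)]
  -- Where h vanishes so does g, so the value of 0 / 0 is harmless.
  refine ENNReal.mul_div_cancel' (fun h0 => ?_) fun h0 => absurd h0 hlt.ne
  exact le_antisymm (h0 ▸ hy) zero_le

theorem exists_convex_combination_eq_one {a b : ENNReal} (ha : a ≤ 1) (hb : 1 ≤ b)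
    (hbt : b ≠ ⊤) : ∃ s t : ENNReal, s + t = 1 ∧ s * a + t * b = 1 := by
  have hat : a ≠ ⊤ := ne_top_of_le_ne_top ENNReal.one_ne_top ha
  have h₁ : a.toReal ≤ 1 := by simpa using ENNReal.toReal_mono ENNReal.one_ne_top ha
  have h₂ : 1 ≤ b.toReal := by simpa using ENNReal.toReal_mono hbt hb
  obtain ⟨s, t, hs, ht, hst, h⟩ := (Convex.mem_Icc (h₁.trans h₂)).1 ⟨h₁, h₂⟩
  refine ⟨ENNReal.ofReal s, ENNReal.ofReal t, ?_, ?_⟩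
  · rw [← ENNReal.ofReal_add hs ht, hst, ENNReal.ofReal_one]
  · conv_lhs => rw [← ENNReal.ofReal_toReal hat, ← ENNReal.ofReal_toReal hbt]
    rw [← ENNReal.ofReal_mul hs, ← ENNReal.ofReal_mul ht,
      ← ENNReal.ofReal_add (by positivity) (by positivity), h, ENNReal.ofReal_one]

/-- Applied to arm 0 when J₀ > 0: there D₀ = j*, so domination by the default laws must be equality.
-/
theorem eq_of_le_of_sum_univ_eq {ι : Type*} [Fintype ι] {μ ν : ι → Measure ℝ}
    [∀ i, IsFiniteMeasure (μ i)] [∀ i, IsFiniteMeasure (ν i)] (h : ∀ i, μ i ≤ ν i)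
    (hsum : ∑ i, μ i Set.univ = ∑ i, ν i Set.univ) (i : ι) : μ i = ν i := by
  refine Measure.eq_of_le_of_measure_univ_eq (h i) ?_
  have h₁ : ∑ i, (μ i).real Set.univ = ∑ i, (ν i).real Set.univ := by
    simp only [Measure.real]
    rw [← ENNReal.toReal_sum fun i _ => measure_ne_top _ _, hsum,
      ENNReal.toReal_sum fun i _ => measure_ne_top _ _]
  have h₂ := (Finset.sum_eq_sum_iff_of_le fun i _ =>
    ENNReal.toReal_mono (measure_ne_top (ν i) _) (h i Set.univ)).1 h₁ i (Finset.mem_univ i)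
  exact (ENNReal.toReal_eq_toReal_iff' (measure_ne_top _ _) (measure_ne_top _ _)).1 h₂

theorem mem_instrFor_of_pos (h : 0 < J₀) {z : Instr J J₀} (hz : ((z : Fin J) : ℕ) = 0)
    (j : Fin J) : z ∈ instrFor J J₀ j := by
  by_contra hn
  obtain ⟨h₁, h₂⟩ := not_mem_instrFor_iff.1 hn
  rw [h₂] at hz
  omega

theorem instrFor_nonempty (hJ : 2 ≤ J) (j : Fin J) : (instrFor J J₀ j).Nonempty := by
  rcases Nat.eq_zero_or_pos J₀ with h | h
  · by_cases hj : (j : ℕ) = 0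
    · refine ⟨⟨⟨1, by omega⟩, Or.inr (by omega)⟩, ?_⟩
      by_contra hn
      have := congrArg Fin.val (not_mem_instrFor_iff.1 hn).2
      simp only at this
      omega
    · refine ⟨⟨⟨0, by omega⟩, Or.inl rfl⟩, ?_⟩
      by_contra hn
      have := congrArg Fin.val (not_mem_instrFor_iff.1 hn).2
      simp only at this
      omega
  · exact ⟨⟨⟨0, by omega⟩, Or.inl rfl⟩, mem_instrFor_of_pos h rfl j⟩

/-- Existence of laws `ν j` of `Y_j` on `{j* = j}` that lie between the lattice supremum of the
untargeted arms and the targeted arm, together with the conditional choice probabilities. -/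
theorem exists_default_laws (hJ : 2 ≤ J) (μ : Instr J J₀ → Fin J → Measure ℝ)
    [∀ z j, IsFiniteMeasure (μ z j)] (hμ : ∀ z, ∑ j, μ z j Set.univ = 1)
    (hpart : ∀ B : Fin J → Instr J J₀ → Set ℝ, (∀ j z, MeasurableSet (B j z)) →
      (∀ j, (instrFor J J₀ j : Set (Instr J J₀)).PairwiseDisjoint (B j)) →
      (∀ j, (⋃ z ∈ instrFor J J₀ j, B j z) = Set.univ) →
      ∑ j, ∑ z ∈ instrFor J J₀ j, μ z j (B j z) ≤ 1)
    (htarget : ∀ z : Instr J J₀, J₀ ≤ ((z : Fin J) : ℕ) → ∀ k, μ k z ≤ μ z z) :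
    ∃ (ν : Fin J → Measure ℝ) (f : Fin J → Instr J J₀ → ℝ → unitInterval),
      (∀ j, IsFiniteMeasure (ν j)) ∧ (∀ j z, Measurable (f j z)) ∧
      ∑ j, ν j Set.univ = 1 ∧
      (∀ j, ∀ z ∈ instrFor J J₀ j, ∀ B, MeasurableSet B →
        ∫⁻ y in B, ENNReal.ofReal (f j z y) ∂ν j = μ z j B) ∧
      (∀ z : Instr J J₀, J₀ ≤ ((z : Fin J) : ℕ) → ν z ≤ μ z z) ∧
      (0 < J₀ → ∀ z : Instr J J₀, ((z : Fin J) : ℕ) = 0 → ∀ j y, f j z y = 1) := by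
  classical
  -- A common dominating measure turns the lattice supremum of measures into a pointwise supremum of
  -- densities.
  let κ : Measure ℝ := ∑ z, ∑ j, μ z j
  have hac : ∀ z j, μ z j ≤ κ := fun z j => Measure.le_iff.2 fun B _ => by
    simp only [κ, Measure.finsetSum_apply]
    exact (Finset.single_le_sum (f := fun j => μ z j B) (fun _ _ => zero_le)
      (Finset.mem_univ j)).trans (Finset.single_le_sum (f := fun z => ∑ j, μ z j B)
        (fun _ _ => zero_le) (Finset.mem_univ z))
  let g : Instr J J₀ → Fin J → ℝ → ENNReal := fun z j => (μ z j).rnDeriv κ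
  have hgm : ∀ z j, Measurable (g z j) := fun z j => Measure.measurable_rnDeriv _ _
  have hg : ∀ z j, κ.withDensity (g z j) = μ z j := fun z j =>
    Measure.withDensity_rnDeriv_eq _ _ (hac z j).absolutelyContinuous
  have hgi : ∀ z j, ∫⁻ y, g z j y ∂κ = μ z j Set.univ := fun z j => by
    rw [← setLIntegral_univ, ← withDensity_apply _ MeasurableSet.univ, hg]
  let M : Fin J → ℝ → ENNReal := fun j y => (instrFor J J₀ j).sup fun z => g z j y
  have hMm : ∀ j, Measurable (M j) := fun j => measurable_finset_sup _ fun z => hgm z j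
  have hgM : ∀ j, ∀ z ∈ instrFor J J₀ j, ∀ y, g z j y ≤ M j y := fun j z hz y =>
    Finset.le_sup (f := fun z => g z j y) hz
  have hM1 : ∑ j, ∫⁻ y, M j y ∂κ ≤ 1 := by
    choose B hB hd hu hs using fun j => exists_partition_sum_lintegral_eq (instrFor J J₀ j)
      (instrFor_nonempty hJ j) (g := fun z => g z j) (fun z => hgm z j) κ
    refine le_trans (le_of_eq ?_) (hpart B hB hd hu)
    refine Finset.sum_congr rfl fun j _ => ?_
    rw [← hs j]
    refine Finset.sum_congr rfl fun z _ => ?_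
    rw [← withDensity_apply _ (hB j z), hg]
  -- For j < J₀ nothing bounds ν_j from above, and taking M_j itself still leaves enough total mass.
  let U : Fin J → ℝ → ENNReal := fun j =>
    if hj : J₀ ≤ (j : ℕ) then g ⟨j, Or.inr hj⟩ j else M j
  have hUm : ∀ j, Measurable (U j) := by
    intro j
    by_cases hj : J₀ ≤ (j : ℕ)
    · simp only [U, dif_pos hj]; exact hgm _ _
    · simp only [U, dif_neg hj]; exact hMm _
  have hMU : ∀ j, M j ≤ᵐ[κ] U j := by
    intro j
    by_cases hj : J₀ ≤ (j : ℕ)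
    · simp only [U, dif_pos hj]
      have h : ∀ z, g z j ≤ᵐ[κ] g ⟨j, Or.inr hj⟩ j := by
        intro z
        refine ae_le_of_forall_setLIntegral_le_of_sigmaFinite (hgm z j) fun s hs _ => ?_
        rw [← withDensity_apply _ hs, ← withDensity_apply _ hs, hg, hg]
        exact htarget ⟨j, Or.inr hj⟩ hj z s
      filter_upwards [ae_all_iff.2 h] with y hy
      exact Finset.sup_le fun z _ => hy z
    · simp only [U, dif_neg hj]; exact Filter.EventuallyLE.refl _ _
  have hUt : ∀ j, ∫⁻ y, U j y ∂κ ≠ ⊤ := by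
    intro j
    by_cases hj : J₀ ≤ (j : ℕ)
    · simp only [U, dif_pos hj, hgi]; exact measure_ne_top _ _
    · simp only [U, dif_neg hj]
      exact ne_top_of_le_ne_top ENNReal.one_ne_top ((Finset.single_le_sum
        (f := fun j => ∫⁻ y, M j y ∂κ) (fun _ _ => zero_le) (Finset.mem_univ j)).trans hM1)
  have hU1 : 1 ≤ ∑ j, ∫⁻ y, U j y ∂κ := by
    -- Arm 0 has mass 1 and lies below `U`: by targeting if J₀ ≤ j, and otherwise because 0 ∈ 𝒵(j).
    rw [← hμ ⟨⟨0, by omega⟩, Or.inl rfl⟩]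
    refine Finset.sum_le_sum fun j _ => ?_
    by_cases hj : J₀ ≤ (j : ℕ)
    · simp only [U, dif_pos hj, hgi]
      exact htarget ⟨j, Or.inr hj⟩ hj _ _
    · simp only [U, dif_neg hj]
      rw [← hgi]
      exact lintegral_mono (hgM j _ (mem_instrFor_of_pos (by omega) rfl j))
  obtain ⟨s, t, hst, hcomb⟩ := exists_convex_combination_eq_one hM1 hU1
    (ENNReal.sum_ne_top.2 fun j _ => hUt j)
  let h : Fin J → ℝ → ENNReal := fun j y => s * M j y + t * U j y
  have hhm : ∀ j, Measurable (h j) := fun j =>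
    ((hMm j).const_mul s).add ((hUm j).const_mul t)
  have hMh : ∀ j, M j ≤ᵐ[κ] h j := by
    intro j
    filter_upwards [hMU j] with y hy
    calc M j y = s * M j y + t * M j y := by rw [← add_mul, hst, one_mul]
      _ ≤ h j y := by simp only [h]; gcongr
  have hhU : ∀ j, h j ≤ᵐ[κ] U j := by
    intro j
    filter_upwards [hMU j] with y hy
    calc h j y ≤ s * U j y + t * U j y := by simp only [h]; gcongr
      _ = U j y := by rw [← add_mul, hst, one_mul]
  have hht : ∀ j, ∫⁻ y, h j y ∂κ ≠ ⊤ := fun j =>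
    ne_top_of_le_ne_top (hUt j) (lintegral_mono_ae (hhU j))
  have hfin : ∀ j, IsFiniteMeasure (κ.withDensity (h j)) := fun j =>
    isFiniteMeasure_withDensity (hht j)
  have hsum : ∑ j, κ.withDensity (h j) Set.univ = 1 := by
    rw [← hcomb, Finset.mul_sum, Finset.mul_sum, ← Finset.sum_add_distrib]
    refine Finset.sum_congr rfl fun j _ => ?_
    rw [withDensity_apply _ MeasurableSet.univ, setLIntegral_univ,
      lintegral_add_left ((hMm j).const_mul s), lintegral_const_mul _ (hMm j),
      lintegral_const_mul _ (hUm j)]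
  have hgh : ∀ j, ∀ z ∈ instrFor J J₀ j, g z j ≤ᵐ[κ] h j := fun j z hz => by
    filter_upwards [hMh j] with y hy using (hgM j z hz y).trans hy
  have hf : ∀ j z, ∃ f : ℝ → unitInterval, Measurable f ∧
      (z ∈ instrFor J J₀ j → ∀ B, MeasurableSet B →
        ∫⁻ y in B, ENNReal.ofReal (f y) ∂(κ.withDensity (h j)) = μ z j B) ∧
      (0 < J₀ → ((z : Fin J) : ℕ) = 0 → ∀ y, f y = 1) := by
    intro j z
    -- The ratio would equal 1 only almost everywhere in arm 0; the constant 1 is used so that D₀ =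
    -- j* holds everywhere.
    by_cases h0 : 0 < J₀ ∧ ((z : Fin J) : ℕ) = 0
    · refine ⟨fun _ => 1, measurable_const, fun _ B hB => ?_, fun _ _ _ => rfl⟩
      have heq := eq_of_le_of_sum_univ_eq (μ := μ z) (ν := fun j => κ.withDensity (h j))
        (fun i => by
          rw [← hg]
          exact withDensity_mono (hgh i z (mem_instrFor_of_pos h0.1 h0.2 i)))
        (by rw [hμ, hsum]) j
      simp [heq]
    · by_cases hz : z ∈ instrFor J J₀ j
      · obtain ⟨f, hfm, hf⟩ := exists_unitInterval_density (hgm z j) (hhm j) (hgh j z hz) (hht j)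
        rw [hg] at hf
        exact ⟨f, hfm, fun _ => hf, fun h h' => absurd ⟨h, h'⟩ h0⟩
      · exact ⟨fun _ => 1, measurable_const, fun h => absurd h hz, fun _ _ _ => rfl⟩
  choose f hfm hfd hf1 using hf
  refine ⟨fun j => κ.withDensity (h j), f, hfin, hfm, hsum, hfd, ?_,
    fun h z h' j => hf1 j z h h'⟩
  intro z hz
  rw [← hg z z]
  refine withDensity_mono ?_
  have := hhU z
  simp only [U, dif_pos hz] at this
  exact this

/-! ### Conditional laws of the observed outcome -/

/-- The sub-probability law of `Y` on `{D = j}` conditional on `Z = z`. -/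
noncomputable def armLaw (P : Measure (Observed J J₀)) (z : Instr J J₀) (j : Fin J) : Measure ℝ :=
  ((cond P {ω | ω.2.2 = z}).restrict {ω | ω.2.1 = j}).map Prod.fst

theorem measurableSet_treatment_eq (j : Fin J) :
    MeasurableSet {ω : Observed J J₀ | ω.2.1 = j} :=
  measurable_snd.fst (measurableSet_singleton j)

theorem armLaw_apply (P : Measure (Observed J J₀)) (z : Instr J J₀) (j : Fin J) {B : Set ℝ}
    (hB : MeasurableSet B) : armLaw P z j B = condProb P B j z := by
  rw [armLaw, Measure.map_apply measurable_fst hB, Measure.restrict_apply (measurable_fst hB)]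
  rfl

instance isFiniteMeasure_armLaw (P : Measure (Observed J J₀)) [IsFiniteMeasure P]
    (z : Instr J J₀) (j : Fin J) : IsFiniteMeasure (armLaw P z j) := by
  unfold armLaw; infer_instance

theorem sum_armLaw_univ {P : Measure (Observed J J₀)} [IsProbabilityMeasure P] {z : Instr J J₀}
    (hz : 0 < P {ω | ω.2.2 = z}) : ∑ j, armLaw P z j Set.univ = 1 := by
  have := cond_isProbabilityMeasure hz.ne'
  have hu := sum_measure_preimage_singleton (μ := cond P {ω | ω.2.2 = z}) Finset.univ
    (f := fun ω : Observed J J₀ => ω.2.1) fun j _ => measurableSet_treatment_eq j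
  rw [Finset.coe_univ, Set.preimage_univ, measure_univ] at hu
  rw [← hu]
  refine Finset.sum_congr rfl fun j _ => ?_
  rw [armLaw, Measure.map_apply measurable_fst MeasurableSet.univ, Set.preimage_univ,
    Measure.restrict_apply_univ]
  rfl

theorem armLaw_inter_outcomeSupport (P : Measure (Observed J J₀)) [IsFiniteMeasure P]
    (z : Instr J J₀) (j : Fin J) (B : Set ℝ) :
    armLaw P z j (B ∩ outcomeSupport P) = armLaw P z j B := by
  refine measure_inter_conull ?_
  have hs := (measurableSet_outcomeSupport P).compl
  have h : P (Prod.fst ⁻¹' (outcomeSupport P)ᶜ) = 0 := by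
    rw [← Measure.map_apply measurable_fst hs]
    exact Measure.measure_compl_support
  rw [armLaw, Measure.map_apply measurable_fst hs]
  exact (Measure.restrict_le_self.absolutelyContinuous.trans cond_absolutelyContinuous) h

end EncouragementDesign

theorem mainTheorem2 (J J₀ : ℕ) (hJ : 2 ≤ J) (hJ₀ : J₀ < J)
    (P : Measure (EncouragementDesign.Observed J J₀)) (hP : IsProbabilityMeasure P)
    (hZ : ∀ z : EncouragementDesign.Instr J J₀, 0 < P {ω | ω.2.2 = z}) :
    (∃ Q : Measure (EncouragementDesign.Latent J J₀), EncouragementDesign.IsModel J J₀ Q ∧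
        P = Q.map EncouragementDesign.Latent.observe) ↔
      EncouragementDesign.PartitionIneq P ∧ EncouragementDesign.TargetingIneq P := by
  open EncouragementDesign in
  constructor
  · rintro ⟨Q, hQ, rfl⟩
    exact ⟨hQ.partitionIneq, hQ.targetingIneq⟩
  · rintro ⟨hpart, htarget⟩
    have hS := measurableSet_outcomeSupport P
    obtain ⟨ν, f, hν, hf, hsum, hdens, hle, h0⟩ := exists_default_laws hJ (armLaw P)
      (fun z => sum_armLaw_univ (hZ z)) (fun B hB hd hu => by
        -- Partitions of the line are cut down to the support, which loses no mass.
        refine le_trans (le_of_eq ?_) (hpart (fun j z => B j z ∩ outcomeSupport P)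
          (fun j z _ => (hB j z).inter hS)
          (fun j => (hd j).mono fun z => Set.inter_subset_left) fun j => ?_)
        · refine Finset.sum_congr rfl fun j _ => Finset.sum_congr rfl fun z _ => ?_
          rw [← armLaw_apply P z j ((hB j z).inter hS), armLaw_inter_outcomeSupport]
        · rw [← Set.iUnion₂_inter, hu, Set.univ_inter])
      (fun z hz k => by
        rcases eq_or_ne k z with rfl | hk
        · exact le_rfl
        refine Measure.le_iff.2 fun B hB => ?_
        rw [← armLaw_inter_outcomeSupport P k, ← armLaw_inter_outcomeSupport P z,
          armLaw_apply P k _ (hB.inter hS), armLaw_apply P z _ (hB.inter hS)]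
        exact htarget _ (hB.inter hS) Set.inter_subset_right z hz k fun h => hk (Subtype.ext h))
    obtain ⟨L, hL, hdef, hLB⟩ := exists_potential_law (armLaw P) ν f hf
      (fun z => sum_armLaw_univ (hZ z)) hsum hdens hle h0
    exact exists_isModel_of_potential_law hZ L hdef fun j z B hB =>
      (hLB j z B hB).trans (armLaw_apply P z j hB)
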